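/- A \emph{tree-like tableau} is a Young diagram $D$ (English notation: left-justified rows of cells, nonempty and of weakly decreasing length from top to bottom) together with a set of cells of $D$, called pointed, such that (1) the top left cell of $D$ is pointed; (2) for every other pointed cell $c$ there is either a pointed cell above $c$ in the same column or a pointed cell to the left of $c$ in the same row, but not both; (3) every row and every column of $D$ contains a pointed cell. Its \emph{size} is its number of pointed cells, and it is \emph{symmetric} if it is unchanged by the reflection in its main diagonal (the line through the North-West and South-East vertices of the top left cell). A \emph{corner} is a cell of $D$ such that $D$ has no cell directly below it and no cell directly to its right; it is \emph{non-occupied} if it is not pointed. \textbf{Corollary.} Let $n\ge 1$. The total number of non-occupied corners, summed over all symmetric tree-like tableaux of size $2n+1$, is $$\begin{cases}1,& n=1,\\[2pt] 2^n\cdot n!\cdot\dfrac{4n+1}{12},& n\ge 2.\end{cases}$$ -/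

import Mathlib

/-- A tree-like tableau: a filling of a diagram without empty rows or columns (a Young diagram in
English notation; the cell in row `i` from the top and column `j` from the left is `(i, j)`,
both counted from `0`) with points in some of its cells. -/
@[ext]
structure TreeLikeTableau where
  /-- the underlying diagram -/
  shape : YoungDiagram
  /-- the pointed cells -/
  points : Finset (ℕ × ℕ)
  /-- points lie in cells of the diagram -/
  points_subset : points ⊆ shape.cells
  /-- the top left cell contains a point (the root point) -/
  root_mem : (0, 0) ∈ points
  /-- every non-root pointed cell has a pointed cell above it in its column or a pointed cell
  to its left in its row, but not both -/
  parent : ∀ c ∈ points, c ≠ (0, 0) →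
    Xor (∃ i < c.1, (i, c.2) ∈ points) (∃ j < c.2, (c.1, j) ∈ points)
  /-- every row contains a point -/
  row_nonempty : ∀ i, (i, 0) ∈ shape → ∃ j, (i, j) ∈ points
  /-- every column contains a point -/
  col_nonempty : ∀ j, (0, j) ∈ shape → ∃ i, (i, j) ∈ points

namespace TreeLikeTableau

/-- The size of a tree-like tableau is its number of points. -/
def size (T : TreeLikeTableau) : ℕ := T.points.card

/-- A tree-like tableau is symmetric if the reflection in the main diagonal leaves both its
diagram and its points unchanged. -/
def IsSymmetric (T : TreeLikeTableau) : Prop :=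
  T.shape.transpose = T.shape ∧ T.points.image Prod.swap = T.points

/-- A corner is a cell whose bottom and right edges both lie on the South-East border of the
diagram, that is, the diagram has no cell directly below it and none directly to its right. -/
def IsCorner (T : TreeLikeTableau) (c : ℕ × ℕ) : Prop :=
  c ∈ T.shape ∧ (c.1 + 1, c.2) ∉ T.shape ∧ (c.1, c.2 + 1) ∉ T.shape

/-- A corner is non-occupied if it contains no point. -/
def IsNonOccupiedCorner (T : TreeLikeTableau) (c : ℕ × ℕ) : Prop :=
  T.IsCorner c ∧ c ∉ T.points

/-- The set of symmetric tree-like tableaux of size `m`. -/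
def symmetricOfSize (m : ℕ) : Set TreeLikeTableau :=
  {T | T.IsSymmetric ∧ T.size = m}

/-- The non-occupied corners of all the tableaux in a set, each recorded together with the
tableau that it belongs to. -/
def nonOccupiedCorners (X : Set TreeLikeTableau) : Set (TreeLikeTableau × (ℕ × ℕ)) :=
  {p | p.1 ∈ X ∧ p.1.IsNonOccupiedCorner p.2}

end TreeLikeTableau

/-! A symmetric tableau of size 2n+1 fills a square box of side n+1, so half of its border is a
vertical step N (`true`) followed by a word w of n letters N and E (`false`). Let f(w) be the number
of tableaux with this border (`wordCount`). A corner above the diagonal is a factor NE. Off the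
first row it is either empty, and can be cut off, or pointed, and then by the parent condition it is
alone in exactly one of its column and its row, which can be deleted with its mirror image. Hence
f(uNEv) = f(uENv) + f(uNv) + f(uEv) (`wordCount_swap`). Moreover f(uE) = f(uN), since by symmetry
only the root is pointed on the diagonal, and f(Ev) = f(v), since the point of a one-cell column is
forced.

Summed over all u of length b, the relation carries an E from behind u to the front at the cost of b
times the sum of f(uv) (`CornerRelation.sum_false`). So S_n, the sum of f over words of length n,
satisfies S_{n+1} = 2(n+1) S_n, whence S_n = 2^n n!. Tableaux with an empty corner at uNEv number
f(uENv); for |u| = b and |u| + |v| = n-2 these sum to (b+1)(S_{n-1} - (b+1) S_{n-2})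
(`sum_wordCount_corner`). Reflection doubles the sum over b, and the diagonal corners, always empty,
add n S_{n-1}. -/

/-! ### Symmetric fillings of a symmetric diagram -/

/-- The set `P` of pointed cells is a symmetric tree-like tableau on the (symmetric) diagram with
set of cells `D`. -/
structure IsSymTab (D : ℕ → ℕ → Prop) (P : Finset (ℕ × ℕ)) : Prop where
  sub : ∀ {i j}, (i, j) ∈ P → D i j
  symm : ∀ {i j}, (i, j) ∈ P → (j, i) ∈ P
  root : (0, 0) ∈ P
  parent : ∀ i j, (i, j) ∈ P → (i, j) ≠ (0, 0) →
    Xor (∃ a < i, (a, j) ∈ P) (∃ b < j, (i, b) ∈ P)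
  row : ∀ i, D i 0 → ∃ j, (i, j) ∈ P

/-- The order embedding of `ℕ` into itself whose range misses exactly `k`. -/
def skip (k x : ℕ) : ℕ := if x < k then x else x + 1

theorem skip_ne (k x : ℕ) : skip k x ≠ k := by
  unfold skip; split <;> omega

theorem skip_lt_skip {k x y : ℕ} : skip k x < skip k y ↔ x < y := by
  unfold skip; split <;> split <;> omega

theorem skip_inj {k x y : ℕ} : skip k x = skip k y ↔ x = y := by
  unfold skip; split <;> split <;> omega

theorem exists_skip {k x : ℕ} (h : x ≠ k) : ∃ y, skip k y = x := by
  rcases lt_or_gt_of_ne h with h | h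
  · exact ⟨x, by simp [skip, h]⟩
  · exact ⟨x - 1, by unfold skip; split <;> omega⟩

theorem skip_zero {k : ℕ} (h : 1 ≤ k) : skip k 0 = 0 := by
  unfold skip; split <;> omega

/-! ### Deleting a row and its mirror column -/

section deletion

variable {D : ℕ → ℕ → Prop} {k m : ℕ} {P Q : Finset (ℕ × ℕ)}

/-- Points of the column of a cell in `P`, in terms of the tableau with row and column `k`
deleted. -/
theorem exists_above_iff (hcor : ∀ i, D i m → i ≤ k)
    (hPQ : ∀ a b, (skip k a, skip k b) ∈ P ↔ (a, b) ∈ Q)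
    (hrow : ∀ j, (k, j) ∈ P ↔ j = m) {a b : ℕ} (hab : D (skip k a) (skip k b)) :
    (∃ x < skip k a, (x, skip k b) ∈ P) ↔ ∃ x < a, (x, b) ∈ Q := by
  constructor
  · rintro ⟨x, hx, hxP⟩
    -- The deleted point of row `k` lies in column `m`, which ends at row `k`, so it is above no
    -- cell of the diagram.
    by_cases hxk : x = k
    · subst hxk
      have := (hrow _).1 hxP
      rw [this] at hab
      exact absurd (hcor _ hab) (by omega)
    · obtain ⟨y, rfl⟩ := exists_skip hxk
      exact ⟨y, skip_lt_skip.1 hx, (hPQ _ _).1 hxP⟩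
  · rintro ⟨x, hx, hxQ⟩
    exact ⟨skip k x, skip_lt_skip.2 hx, (hPQ _ _).2 hxQ⟩

theorem exists_left_iff (hcor : ∀ j, D m j → j ≤ k)
    (hPQ : ∀ a b, (skip k a, skip k b) ∈ P ↔ (a, b) ∈ Q)
    (hcol : ∀ i, (i, k) ∈ P ↔ i = m) {a b : ℕ} (hab : D (skip k a) (skip k b)) :
    (∃ x < skip k b, (skip k a, x) ∈ P) ↔ ∃ x < b, (a, x) ∈ Q := by
  constructor
  · rintro ⟨x, hx, hxP⟩
    by_cases hxk : x = k
    · subst hxk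
      have := (hcol _).1 hxP
      rw [this] at hab
      exact absurd (hcor _ hab) (by omega)
    · obtain ⟨y, rfl⟩ := exists_skip hxk
      exact ⟨y, skip_lt_skip.1 hx, (hPQ _ _).1 hxP⟩
  · rintro ⟨x, hx, hxQ⟩
    exact ⟨skip k x, skip_lt_skip.2 hx, (hPQ _ _).2 hxQ⟩

/-- Deleting row and column `k`, when each of them contains a single point and these points lie
in the corners `(k, m)` and `(m, k)`. -/
theorem isSymTab_iff_skip (hk : 1 ≤ k) (hkm : m ≠ k) (hsymm : ∀ i j, D i j → D j i)
    (hmk : D m k) (hm0 : D m 0) (hcor : ∀ j, D m j → j ≤ k)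
    (hPQ : ∀ a b, (skip k a, skip k b) ∈ P ↔ (a, b) ∈ Q)
    (hcol : ∀ i, (i, k) ∈ P ↔ i = m) (hrow : ∀ j, (k, j) ∈ P ↔ j = m) :
    IsSymTab D P ↔ IsSymTab (fun i j => D (skip k i) (skip k j)) Q := by
  have hcor' : ∀ i, D i m → i ≤ k := fun i hi => hcor i (hsymm _ _ hi)
  have h0 := skip_zero hk
  constructor
  · intro h
    refine ⟨fun hab => h.sub ((hPQ _ _).2 hab),
      fun hab => (hPQ _ _).1 (h.symm ((hPQ _ _).2 hab)), ?_, ?_, ?_⟩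
    · rw [← hPQ, h0]; exact h.root
    · intro a b hab hne
      have hP := (hPQ _ _).2 hab
      rw [← exists_above_iff hcor' hPQ hrow (h.sub hP), ← exists_left_iff hcor hPQ hcol (h.sub hP)]
      refine h.parent _ _ hP fun he => hne ?_
      simp only [Prod.mk.injEq] at he ⊢
      rw [← h0, skip_inj, h0, ← h0, skip_inj] at he
      simpa [h0] using he
    · intro a ha
      rw [h0] at ha
      obtain ⟨j, hj⟩ := h.row _ ha
      by_cases hjk : j = k
      · subst hjk
        have ham := (hcol _).1 hj
        -- The only point of the deleted column has its parent to the left, and this parent keeps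
        -- the row nonempty.
        have hx := h.parent _ _ hj (by simp; omega)
        rcases hx with ⟨⟨x, hx, hxP⟩, -⟩ | ⟨⟨x, hx, hxP⟩, -⟩
        · rw [hcol] at hxP; omega
        · obtain ⟨y, rfl⟩ := exists_skip hx.ne
          exact ⟨y, (hPQ _ _).1 hxP⟩
      · obtain ⟨y, rfl⟩ := exists_skip hjk
        exact ⟨y, (hPQ _ _).1 hj⟩
  · intro h
    -- Row `m` ends at column `k` and has a point that survives deletion: this is the parent of the
    -- reinserted point `(m, k)`.
    have hleft : ∃ x < k, (m, x) ∈ P := by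
      obtain ⟨a, ha⟩ := exists_skip hkm
      obtain ⟨j, hj⟩ := h.row a (by rw [ha, h0]; exact hm0)
      refine ⟨skip k j, ?_, by rw [← ha, hPQ]; exact hj⟩
      have h1 : D (skip k a) (skip k j) := h.sub hj
      rw [ha] at h1
      exact lt_of_le_of_ne (hcor _ h1) (skip_ne _ _)
    have hsy : ∀ {i j}, (i, j) ∈ P → (j, i) ∈ P := by
      intro i j hij
      by_cases hjk : j = k
      · subst hjk; rw [hcol] at hij; rw [hrow]; exact hij
      by_cases hik : i = k
      · subst hik; rw [hrow] at hij; rw [hcol]; exact hij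
      obtain ⟨a, rfl⟩ := exists_skip hik
      obtain ⟨b, rfl⟩ := exists_skip hjk
      rw [hPQ] at hij ⊢
      exact h.symm hij
    refine ⟨?_, hsy, ?_, ?_, ?_⟩
    · intro i j hij
      by_cases hjk : j = k
      · subst hjk; rw [(hcol _).1 hij]; exact hmk
      by_cases hik : i = k
      · subst hik; rw [(hrow _).1 hij]; exact hsymm _ _ hmk
      obtain ⟨a, rfl⟩ := exists_skip hik
      obtain ⟨b, rfl⟩ := exists_skip hjk
      exact h.sub ((hPQ _ _).1 hij)
    · have := (hPQ _ _).2 h.root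
      rwa [h0] at this
    · intro i j hij hne
      by_cases hjk : j = k
      · subst hjk
        have him := (hcol _).1 hij
        subst him
        refine Or.inr ⟨hleft, ?_⟩
        rintro ⟨x, hx, hxP⟩
        rw [hcol] at hxP; omega
      by_cases hik : i = k
      · subst hik
        have him := (hrow _).1 hij
        subst him
        refine Or.inl ⟨?_, ?_⟩
        · obtain ⟨x, hx, hxP⟩ := hleft
          exact ⟨x, hx, hsy hxP⟩
        · rintro ⟨x, hx, hxP⟩
          rw [hrow] at hxP; omega
      obtain ⟨a, rfl⟩ := exists_skip hik
      obtain ⟨b, rfl⟩ := exists_skip hjk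
      have hQ := (hPQ _ _).1 hij
      rw [exists_above_iff hcor' hPQ hrow (h.sub hQ), exists_left_iff hcor hPQ hcol (h.sub hQ)]
      refine h.parent _ _ hQ fun he => hne ?_
      simp only [Prod.mk.injEq] at he ⊢
      rw [he.1, he.2, h0]
      exact ⟨rfl, rfl⟩
    · intro i hi
      by_cases hik : i = k
      · subst hik; exact ⟨m, (hrow _).2 rfl⟩
      obtain ⟨a, rfl⟩ := exists_skip hik
      obtain ⟨j, hj⟩ := h.row a (by rw [h0]; exact hi)
      exact ⟨_, (hPQ _ _).2 hj⟩

end deletion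

/-- The number of symmetric tree-like tableaux on `D`. -/
noncomputable def symTabCount (D : ℕ → ℕ → Prop) : ℕ := {P | IsSymTab D P}.ncard

theorem finite_isSymTab {D : ℕ → ℕ → Prop} {n : ℕ} (hD : ∀ i j, D i j → i < n ∧ j < n) :
    {P | IsSymTab D P}.Finite := by
  refine (Finset.finite_toSet (Finset.range n ×ˢ Finset.range n).powerset).subset ?_
  intro P hP
  simp only [Finset.coe_powerset, Set.mem_preimage, Set.mem_powerset_iff]
  rintro ⟨i, j⟩ hij
  simpa using hD i j (hP.sub hij)

/-- The tableaux whose column `k` has its only point in the corner `(m, k)` are counted by the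
tableaux on the diagram with row and column `k` deleted. -/
theorem ncard_single_column {D : ℕ → ℕ → Prop} {k m : ℕ} (hk : 1 ≤ k) (hkm : m ≠ k)
    (hsymm : ∀ i j, D i j → D j i)
    (hmk : D m k) (hm0 : D m 0) (hcor : ∀ j, D m j → j ≤ k) :
    {P | IsSymTab D P ∧ ∀ i, (i, k) ∈ P ↔ i = m}.ncard =
      symTabCount fun i j => D (skip k i) (skip k j) := by
  classical
  have hinj : Function.Injective (Prod.map (skip k) (skip k)) :=
    Function.Injective.prodMap (fun _ _ => skip_inj.1) (fun _ _ => skip_inj.1)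
  let ins : Finset (ℕ × ℕ) → Finset (ℕ × ℕ) := fun Q =>
    Q.image (Prod.map (skip k) (skip k)) ∪ {(m, k), (k, m)}
  have hPQ : ∀ Q a b, (skip k a, skip k b) ∈ ins Q ↔ (a, b) ∈ Q := by
    intro Q a b
    simp [ins, skip_inj, skip_ne]
  have hcol : ∀ Q i, (i, k) ∈ ins Q ↔ i = m := by
    intro Q i
    simp [ins, skip_ne]
    omega
  have hrow : ∀ Q j, (k, j) ∈ ins Q ↔ j = m := by
    intro Q i
    simp [ins, skip_ne]
    omega
  unfold symTabCount
  rw [← Set.ncard_image_of_injective (f := ins)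
    {Q | IsSymTab (fun i j => D (skip k i) (skip k j)) Q} ?_]
  · congr 1
    ext P
    constructor
    · rintro ⟨hP, hPc⟩
      have hPr : ∀ j, (k, j) ∈ P ↔ j = m := fun j =>
        ⟨fun h => (hPc _).1 (hP.symm h), fun h => hP.symm ((hPc _).2 h)⟩
      refine ⟨P.preimage _ hinj.injOn, ?_, ?_⟩
      · exact (isSymTab_iff_skip hk hkm hsymm hmk hm0 hcor (by simp) hPc hPr).1 hP
      · ext ⟨i, j⟩
        by_cases hjk : j = k
        · subst hjk; rw [hcol, hPc]
        by_cases hik : i = k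
        · subst hik; rw [hrow, hPr]
        obtain ⟨a, rfl⟩ := exists_skip hik
        obtain ⟨b, rfl⟩ := exists_skip hjk
        rw [hPQ]; simp
    · rintro ⟨Q, hQ, rfl⟩
      exact ⟨(isSymTab_iff_skip hk hkm hsymm hmk hm0 hcor (hPQ Q) (hcol Q) (hrow Q)).2 hQ, hcol Q⟩
  · intro Q Q' h
    ext ⟨a, b⟩
    rw [← hPQ, h, hPQ]

/-- The tableaux in which the corner `(r, c)` is empty are the tableaux on the diagram without
that corner and its mirror image. -/
theorem isSymTab_and_notMem_iff {D D' : ℕ → ℕ → Prop} {r c : ℕ} (hr : 1 ≤ r) (hc : 1 ≤ c)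
    (hD' : ∀ i j, D' i j ↔ D i j ∧ (i, j) ≠ (r, c) ∧ (i, j) ≠ (c, r)) (P : Finset (ℕ × ℕ)) :
    IsSymTab D P ∧ (r, c) ∉ P ↔ IsSymTab D' P := by
  -- As `r, c ≥ 1`, column `0` is untouched, so the same rows have to be nonempty.
  have h0 : ∀ i, D' i 0 ↔ D i 0 := fun i => by rw [hD']; simp; omega
  constructor
  · rintro ⟨h, hP⟩
    refine ⟨fun {i j} hij => (hD' _ _).2 ⟨h.sub hij, ?_, ?_⟩, h.symm, h.root, h.parent,
      fun i hi => h.row i ((h0 i).1 hi)⟩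
    · intro he; rw [he] at hij; exact hP hij
    · intro he; rw [he] at hij; exact hP (h.symm hij)
  · intro h
    refine ⟨⟨fun hij => ((hD' _ _).1 (h.sub hij)).1, h.symm, h.root, h.parent,
      fun i hi => h.row i ((h0 i).2 hi)⟩, fun hP => ?_⟩
    exact ((hD' _ _).1 (h.sub hP)).2.1 rfl

/-- A point on the diagonal is the root. -/
theorem IsSymTab.eq_zero_of_diag {D : ℕ → ℕ → Prop} {P : Finset (ℕ × ℕ)} (h : IsSymTab D P)
    {i : ℕ} (hi : (i, i) ∈ P) : i = 0 := by
  by_contra hne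
  have := h.parent i i hi (by simpa using hne)
  rcases this with ⟨⟨a, ha, haP⟩, hn⟩ | ⟨⟨a, ha, haP⟩, hn⟩
  · exact hn ⟨a, ha, h.symm haP⟩
  · exact hn ⟨a, ha, h.symm haP⟩

/-- A tableau with a point in the corner `(r, c)` has no other point in row `r` or no other point
in column `c`. -/
theorem symTabCount_corner {D D' : ℕ → ℕ → Prop} {r c n : ℕ} (hr : 1 ≤ r) (hrc : r < c)
    (hfin : ∀ i j, D i j → i < n ∧ j < n) (hsymm : ∀ i j, D i j → D j i)
    (hrD : D r c) (hr0 : D r 0) (hc0 : D c 0)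
    (hrow : ∀ j, D r j → j ≤ c) (hcol : ∀ i, D i c → i ≤ r)
    (hD' : ∀ i j, D' i j ↔ D i j ∧ (i, j) ≠ (r, c) ∧ (i, j) ≠ (c, r)) :
    symTabCount D = symTabCount D' + symTabCount (fun i j => D (skip c i) (skip c j)) +
      symTabCount (fun i j => D (skip r i) (skip r j)) := by
  rw [← ncard_single_column (D := D) (k := c) (m := r) (by omega) (by omega) hsymm hrD hr0 hrow,
    ← ncard_single_column (D := D) (k := r) (m := c) hr (by omega) hsymm (hsymm _ _ hrD) hc0
      (fun j hj => hcol j (hsymm _ _ hj))]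
  have hF := finite_isSymTab hfin
  have e1 : symTabCount D' = {P | IsSymTab D P ∧ (r, c) ∉ P}.ncard := by
    unfold symTabCount
    congr 1
    ext P
    exact (isSymTab_and_notMem_iff hr (by omega) hD' P).symm
  -- At a corner, being alone in the column means having no point above, and being alone in the row
  -- means having none to the left; the exclusive parent condition then selects exactly one case.
  have key : ∀ P, IsSymTab D P → (r, c) ∈ P →
      ((∀ i, (i, c) ∈ P ↔ i = r) ↔ ¬ ∃ a < r, (a, c) ∈ P) ∧
      ((∀ i, (i, r) ∈ P ↔ i = c) ↔ ¬ ∃ b < c, (r, b) ∈ P) := by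
    intro P hP hm
    refine ⟨⟨?_, ?_⟩, ?_, ?_⟩
    · rintro h ⟨a, ha, haP⟩
      rw [h] at haP; omega
    · intro h i
      refine ⟨fun hi => ?_, fun hi => hi ▸ hm⟩
      have := hcol i (hP.sub hi)
      by_contra hne
      exact h ⟨i, by omega, hi⟩
    · rintro h ⟨a, ha, haP⟩
      have := (h _).1 (hP.symm haP); omega
    · intro h i
      refine ⟨fun hi => ?_, fun hi => hi ▸ hP.symm hm⟩
      have := hrow i (hP.sub (hP.symm hi))
      by_contra hne
      exact h ⟨i, by omega, hP.symm hi⟩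
  rw [e1, ← Set.ncard_union_eq ?_ (hF.subset fun P h => h.1) (hF.subset fun P h => h.1),
    ← Set.ncard_union_eq ?_ ((hF.subset fun P h => h.1).union (hF.subset fun P h => h.1))
      (hF.subset fun P h => h.1)]
  · unfold symTabCount
    congr 1
    ext P
    simp only [Set.mem_ofPred_eq, Set.mem_union]
    constructor
    · intro h
      by_cases hm : (r, c) ∈ P
      · have hk := key P h hm
        rcases h.parent _ _ hm (by simp; omega) with ⟨-, h2⟩ | ⟨-, h2⟩
        · exact Or.inr ⟨h, hk.2.2 h2⟩
        · exact Or.inl (Or.inr ⟨h, hk.1.2 h2⟩)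
      · exact Or.inl (Or.inl ⟨h, hm⟩)
    · rintro ((h | h) | h) <;> exact h.1
  · rw [Set.disjoint_left]
    rintro P (⟨h, hm⟩ | ⟨h, hc⟩) ⟨-, h2⟩
    · exact hm (h.symm ((h2 _).2 rfl))
    · have hm := (hc r).2 rfl
      have hk := key P h hm
      rcases h.parent _ _ hm (by simp; omega) with ⟨h3, -⟩ | ⟨h3, -⟩
      · exact hk.1.1 hc h3
      · exact hk.2.1 h2 h3
  · rw [Set.disjoint_left]
    rintro P ⟨h, hm⟩ ⟨-, h2⟩
    exact hm ((h2 _).2 rfl)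

/-- A diagonal cell other than the root is never pointed, so no filling is lost without it. -/
theorem symTabCount_diag {D D' : ℕ → ℕ → Prop} {k : ℕ} (hk : 1 ≤ k)
    (hD' : ∀ i j, D' i j ↔ D i j ∧ (i, j) ≠ (k, k)) : symTabCount D' = symTabCount D := by
  unfold symTabCount
  congr 1
  ext P
  rw [Set.mem_ofPred_eq, Set.mem_ofPred_eq,
    ← isSymTab_and_notMem_iff (D := D) (r := k) (c := k) hk hk (by simpa using hD')]
  exact ⟨fun h => h.1, fun h => ⟨h, fun hP => absurd (h.eq_zero_of_diag hP) (by omega)⟩⟩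

/-- The column mirrors a nonempty row, so its single cell must carry a point. -/
theorem IsSymTab.mem_of_column {D : ℕ → ℕ → Prop} {P : Finset (ℕ × ℕ)} (h : IsSymTab D P)
    {c m : ℕ} (hc0 : D c 0) (hc : ∀ i, D i c ↔ i = m) (i : ℕ) : (i, c) ∈ P ↔ i = m := by
  obtain ⟨j, hj⟩ := h.row c hc0
  have hj' := h.symm hj
  have := (hc _).1 (h.sub hj')
  subst this
  exact ⟨fun hi => (hc _).1 (h.sub hi), fun hi => hi ▸ hj'⟩

/-- Deleting a column of length one, and its mirror image. -/
theorem symTabCount_column {D : ℕ → ℕ → Prop} {c : ℕ} (hc1 : 1 ≤ c)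
    (hsymm : ∀ i j, D i j → D j i) (h00 : D 0 0) (hc : ∀ i, D i c ↔ i = 0)
    (hrow : ∀ j, D 0 j → j ≤ c) :
    symTabCount D = symTabCount fun i j => D (skip c i) (skip c j) := by
  rw [← ncard_single_column (D := D) (k := c) (m := 0) hc1 (by omega) hsymm ((hc _).2 rfl) h00 hrow]
  unfold symTabCount
  congr 1
  ext P
  exact ⟨fun h => ⟨h, h.mem_of_column (hsymm _ _ ((hc _).2 rfl)) hc⟩, fun h => h.1⟩

/-! ### Symmetric diagrams as words -/

/-- The cells of the symmetric diagram in an `n × n` box that is given by the half of its border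
from the upper right corner of the box to the diagonal: the letters of the list, `n` in
number, stand for vertical (`true`) and horizontal (`false`) steps. A vertical step adds a hook. -/
def cell : List Bool → ℕ → ℕ → Prop
  | [], _, _ => False
  | false :: l, r, c => cell l r c
  | true :: l, 0, c => c ≤ l.length
  | true :: l, r + 1, 0 => r + 1 ≤ l.length
  | true :: l, r + 1, c + 1 => cell l r c

theorem cell_symm : ∀ (l : List Bool) (r c : ℕ), cell l r c → cell l c r
  | [], _, _, h => h
  | false :: l, r, c, h => cell_symm l r c h
  | true :: _, 0, 0, h => h
  | true :: _, 0, _ + 1, h => h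
  | true :: _, _ + 1, 0, h => h
  | true :: l, r + 1, c + 1, h => cell_symm l r c h

theorem cell_lt : ∀ (l : List Bool) (r c : ℕ), cell l r c → r < l.length ∧ c < l.length
  | [], _, _, h => h.elim
  | false :: l, r, c, h => by have := cell_lt l r c h; simp; omega
  | true :: l, 0, c, h => by simp only [cell] at h; simp; omega
  | true :: l, r + 1, 0, h => by simp only [cell] at h; simp; omega
  | true :: l, r + 1, c + 1, h => by have := cell_lt l r c h; simp; omega

theorem cell_succ_left : ∀ (l : List Bool) (r c : ℕ), cell l (r + 1) c → cell l r c
  | [], _, _, h => h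
  | false :: l, r, c, h => cell_succ_left l r c h
  | true :: l, 0, 0, _ => by simp [cell]
  | true :: l, 0, c + 1, h => (cell_lt l 0 c h).2
  | true :: l, r + 1, 0, h => by simp only [cell] at h ⊢; omega
  | true :: l, r + 1, c + 1, h => cell_succ_left l r c h

theorem cell_mono_left (l : List Bool) {r r' c : ℕ} (h : cell l r c) (hr : r' ≤ r) :
    cell l r' c := by
  induction r, hr using Nat.le_induction with
  | base => exact h
  | succ r _ ih => exact ih (cell_succ_left _ _ _ h)

theorem cell_mono (l : List Bool) {r r' c c' : ℕ} (h : cell l r c) (hr : r' ≤ r) (hc : c' ≤ c) :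
    cell l r' c' :=
  cell_symm _ _ _ (cell_mono_left l (cell_symm _ _ _ (cell_mono_left l h hr)) hc)

/-- A corner of the diagram of `l`. -/
def IsCellCorner (l : List Bool) (r c : ℕ) : Prop :=
  cell l r c ∧ ¬ cell l (r + 1) c ∧ ¬ cell l r (c + 1)

/-- Each `true` before the corner strips a hook and shifts both coordinates by one; a `false` only
shrinks the box. What remains is a box of side `v.length + 2`, with the corner at the end of its
first row. -/
theorem isCellCorner_iff : ∀ (l : List Bool) (r c : ℕ), r < c → (IsCellCorner l r c ↔
    ∃ u v, l = u ++ true :: false :: v ∧ r = u.count true ∧ c = r + v.length + 1)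
  | [], r, c, _ => by simp [IsCellCorner, cell]
  | false :: l, r, c, h => by
    have ih := isCellCorner_iff l r c h
    have e : IsCellCorner (false :: l) r c ↔ IsCellCorner l r c := Iff.rfl
    rw [e, ih]
    constructor
    · rintro ⟨u, v, rfl, h1, h2⟩
      exact ⟨false :: u, v, rfl, by simpa using h1, h2⟩
    · rintro ⟨u, v, hl, h1, h2⟩
      rcases u with _ | ⟨x, u⟩
      · simp at hl
      · simp only [List.cons_append, List.cons.injEq] at hl
        obtain ⟨rfl, rfl⟩ := hl
        exact ⟨u, v, rfl, by simpa using h1, h2⟩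
  | true :: l, 0, 0, h => by omega
  | true :: l, 0, c + 1, _ => by
    constructor
    · rintro ⟨h1, h2, h3⟩
      simp only [cell] at h1 h2 h3
      have hc : c + 1 = l.length := by omega
      rcases l with _ | ⟨_ | _, v⟩
      · simp at hc
      · exact ⟨[], v, rfl, rfl, by simpa using hc⟩
      · simp only [cell] at h2
        simp at hc; omega
    · rintro ⟨u, v, hl, h1, h2⟩
      rcases u with _ | ⟨x, u⟩
      · simp only [List.nil_append, List.cons.injEq] at hl
        obtain ⟨-, rfl⟩ := hl
        have hc : c = v.length := by omega
        subst hc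
        refine ⟨by simp [cell], fun h => ?_, by simp [cell]⟩
        exact absurd (cell_lt v _ _ h).2 (by omega)
      · simp only [List.cons_append, List.cons.injEq] at hl
        obtain ⟨rfl, rfl⟩ := hl
        simp at h1
  | true :: l, r + 1, 0, h => by omega
  | true :: l, r + 1, c + 1, h => by
    have ih := isCellCorner_iff l r c (by omega)
    have e : IsCellCorner (true :: l) (r + 1) (c + 1) ↔ IsCellCorner l r c := Iff.rfl
    rw [e, ih]
    constructor
    · rintro ⟨u, v, rfl, h1, h2⟩
      exact ⟨true :: u, v, rfl, by simpa using h1, by omega⟩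
    · rintro ⟨u, v, hl, h1, h2⟩
      rcases u with _ | ⟨x, u⟩
      · simp at h1
      · simp only [List.cons_append, List.cons.injEq] at hl
        obtain ⟨rfl, rfl⟩ := hl
        exact ⟨u, v, rfl, by simpa using h1, by omega⟩

theorem isCellCorner_diag_iff : ∀ (l : List Bool) (r : ℕ), IsCellCorner l r r ↔
    ∃ u, l = u ++ [true] ∧ r = u.count true
  | [], r => by simp [IsCellCorner, cell]
  | false :: l, r => by
    have ih := isCellCorner_diag_iff l r
    have e : IsCellCorner (false :: l) r r ↔ IsCellCorner l r r := Iff.rfl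
    rw [e, ih]
    constructor
    · rintro ⟨u, rfl, h1⟩
      exact ⟨false :: u, rfl, by simpa using h1⟩
    · rintro ⟨u, hl, h1⟩
      rcases u with _ | ⟨x, u⟩
      · simp at hl
      · simp only [List.cons_append, List.cons.injEq] at hl
        obtain ⟨rfl, rfl⟩ := hl
        exact ⟨u, rfl, by simpa using h1⟩
  | true :: l, 0 => by
    constructor
    · rintro ⟨h1, h2, h3⟩
      simp only [cell] at h3
      have hc : l = [] := by rcases l with _ | ⟨x, l⟩ <;> simp_all
      exact ⟨[], by simp [hc], rfl⟩
    · rintro ⟨u, hl, h1⟩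
      rcases u with _ | ⟨x, u⟩
      · simp only [List.nil_append, List.cons.injEq] at hl
        obtain ⟨-, rfl⟩ := hl
        simp [IsCellCorner, cell]
      · simp only [List.cons_append, List.cons.injEq] at hl
        obtain ⟨rfl, rfl⟩ := hl
        simp at h1
  | true :: l, r + 1 => by
    have ih := isCellCorner_diag_iff l r
    have e : IsCellCorner (true :: l) (r + 1) (r + 1) ↔ IsCellCorner l r r := Iff.rfl
    rw [e, ih]
    constructor
    · rintro ⟨u, rfl, h1⟩
      exact ⟨true :: u, rfl, by simpa using h1⟩
    · rintro ⟨u, hl, h1⟩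
      rcases u with _ | ⟨x, u⟩
      · simp at h1
      · simp only [List.cons_append, List.cons.injEq] at hl
        obtain ⟨rfl, rfl⟩ := hl
        exact ⟨u, rfl, by simpa using h1⟩

/-! ### Corner removal and deletion as operations on words -/

theorem skip_succ_succ (k x : ℕ) : skip (k + 1) (x + 1) = skip k x + 1 := by
  unfold skip; split <;> split <;> omega

theorem skip_of_lt {k x : ℕ} (h : x < k) : skip k x = x := by simp [skip, h]

theorem cell_skip_length (l : List Bool) (r c : ℕ) :
    cell l (skip l.length r) (skip l.length c) ↔ cell l r c := by
  by_cases h : r < l.length ∧ c < l.length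
  · rw [skip_of_lt h.1, skip_of_lt h.2]
  · refine iff_of_false (fun h' => h ?_) fun h' => h (cell_lt _ _ _ h')
    have := cell_lt _ _ _ h'
    unfold skip at this
    split at this <;> split at this <;> omega

/-- Removing a corner off the diagonal exchanges two letters. -/
theorem cell_swap (v : List Bool) : ∀ (u : List Bool) (r c : ℕ),
    cell (u ++ false :: true :: v) r c ↔ cell (u ++ true :: false :: v) r c ∧
      (r, c) ≠ (u.count true, u.count true + v.length + 1) ∧
      (r, c) ≠ (u.count true + v.length + 1, u.count true)
  | [], 0, c => by simp [cell]; omega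
  | [], r + 1, 0 => by simp [cell]; omega
  | [], r + 1, c + 1 => by
    simp [cell]
  | false :: u, r, c => by simpa [cell] using cell_swap v u r c
  | true :: u, 0, c => by simp [cell]
  | true :: u, r + 1, 0 => by simp [cell]
  | true :: u, r + 1, c + 1 => by
    have := cell_swap v u r c
    simp only [List.cons_append, cell, this, List.count_cons_self, ne_eq, Prod.mk.injEq]
    refine and_congr_right fun _ => ?_
    omega

/-- Deleting the row of a corner erases its vertical step. -/
theorem cell_skip_row (v : List Bool) : ∀ (u : List Bool) (r c : ℕ),
    cell (u ++ true :: false :: v) (skip (u.count true) r) (skip (u.count true) c) ↔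
      cell (u ++ false :: v) r c
  | [], r, c => by simp [cell, skip]
  | false :: u, r, c => by simpa [cell] using cell_skip_row v u r c
  | true :: u, 0, c => by
    have := List.count_le_length (a := true) (l := u)
    simp only [List.cons_append, List.count_cons_self, skip_zero (Nat.le_add_left 1 _), cell]
    unfold skip
    split <;> simp <;> omega
  | true :: u, r + 1, 0 => by
    have := List.count_le_length (a := true) (l := u)
    simp only [List.cons_append, List.count_cons_self, skip_zero (Nat.le_add_left 1 _),
      skip_succ_succ, cell]
    unfold skip
    split <;> simp <;> omega
  | true :: u, r + 1, c + 1 => by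
    simpa only [List.cons_append, List.count_cons_self, skip_succ_succ, cell] using
      cell_skip_row v u r c

/-- Deleting the column of a corner erases its horizontal step. -/
theorem cell_skip_column (v : List Bool) : ∀ (u : List Bool) (r c : ℕ),
    cell (u ++ true :: false :: v) (skip (u.count true + v.length + 1) r)
      (skip (u.count true + v.length + 1) c) ↔ cell (u ++ true :: v) r c
  | [], 0, c => by
    simp only [List.nil_append, skip_zero (Nat.le_add_left 1 _), cell]
    unfold skip
    split <;> simp at * <;> omega
  | [], r + 1, 0 => by
    simp only [List.nil_append, skip_zero (Nat.le_add_left 1 _), skip_succ_succ, cell]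
    unfold skip
    split <;> simp at * <;> omega
  | [], r + 1, c + 1 => by
    simpa only [List.nil_append, skip_succ_succ, cell, List.count_nil, zero_add] using
      cell_skip_length v r c
  | false :: u, r, c => by simpa [cell] using cell_skip_column v u r c
  | true :: u, 0, c => by
    have := List.count_le_length (a := true) (l := u)
    simp only [List.cons_append, List.count_cons_self, skip_zero (Nat.le_add_left 1 _), cell]
    unfold skip
    split <;> simp <;> omega
  | true :: u, r + 1, 0 => by
    have := List.count_le_length (a := true) (l := u)
    simp only [List.cons_append, List.count_cons_self, skip_zero (Nat.le_add_left 1 _),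
      skip_succ_succ, cell]
    unfold skip
    split <;> simp <;> omega
  | true :: u, r + 1, c + 1 => by
    have := cell_skip_column v u r c
    rw [show (true :: u).count true + v.length + 1 = u.count true + v.length + 1 + 1 by
      rw [List.count_cons_self]; omega]
    simpa only [List.cons_append, skip_succ_succ, cell] using this

theorem cell_diag : ∀ (u : List Bool) (r c : ℕ),
    cell (u ++ [false]) r c ↔ cell (u ++ [true]) r c ∧ (r, c) ≠ (u.count true, u.count true)
  | [], 0, c => by simp [cell]
  | [], r + 1, 0 => by simp [cell]
  | [], r + 1, c + 1 => by simp [cell]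
  | false :: u, r, c => by simpa [cell] using cell_diag u r c
  | true :: u, 0, c => by simp [cell]
  | true :: u, r + 1, 0 => by simp [cell]
  | true :: u, r + 1, c + 1 => by simpa [cell] using cell_diag u r c

/-- The number of symmetric tree-like tableaux whose half border, after its first vertical step,
is `w`. -/
noncomputable def wordCount (w : List Bool) : ℕ := symTabCount (cell (true :: w))

theorem cell_zero_of (l : List Bool) {r c : ℕ} (h : cell l r c) : cell l r 0 ∧ cell l c 0 :=
  ⟨cell_mono l h le_rfl (Nat.zero_le _), cell_mono l (cell_symm _ _ _ h) le_rfl (Nat.zero_le _)⟩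

theorem wordCount_swap (u v : List Bool) : wordCount (u ++ true :: false :: v) =
    wordCount (u ++ false :: true :: v) + wordCount (u ++ true :: v) +
      wordCount (u ++ false :: v) := by
  unfold wordCount
  simp only [← List.cons_append]
  generalize hU : true :: u = U
  -- The initial vertical step keeps the corner out of row `0`.
  have hr : 1 ≤ U.count true := by rw [← hU]; simp
  have hrc : U.count true < U.count true + v.length + 1 := by omega
  obtain ⟨h1, h2, h3⟩ := (isCellCorner_iff (U ++ true :: false :: v) _ _ hrc).2 ⟨U, v, rfl, rfl, rfl⟩
  have h0 := cell_zero_of _ h1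
  rw [symTabCount_corner hr hrc (cell_lt _) (cell_symm _) h1 h0.1 h0.2 ?_ ?_ (cell_swap v U)]
  · congr 1
    · congr 1
      congr 1
      ext i j
      exact cell_skip_column v U i j
    · congr 1
      ext i j
      exact cell_skip_row v U i j
  · intro j hj
    by_contra hlt
    exact h3 (cell_mono _ hj le_rfl (by omega))
  · intro j hj
    by_contra hlt
    exact h2 (cell_mono _ hj (by omega) le_rfl)

theorem wordCount_append_false (u : List Bool) :
    wordCount (u ++ [false]) = wordCount (u ++ [true]) := by
  unfold wordCount
  simp only [← List.cons_append]
  exact symTabCount_diag (by simp) (cell_diag (true :: u))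

theorem cell_last_column (w : List Bool) (i : ℕ) :
    cell (true :: false :: w) i (w.length + 1) ↔ i = 0 := by
  rcases i with _ | i
  · simp [cell]
  · refine iff_of_false (fun h => ?_) (by simp)
    exact absurd (cell_lt w i _ h).2 (by omega)

/-- A horizontal step right after the first vertical one makes the last column a single, hence
pointed, cell. -/
theorem wordCount_false_cons (w : List Bool) : wordCount (false :: w) = wordCount w := by
  unfold wordCount
  rw [symTabCount_column (c := w.length + 1) (by omega) (cell_symm _) (by simp [cell])
    (cell_last_column w) (fun j hj => by simpa [cell] using hj)]
  congr 1
  ext i j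
  simpa using cell_skip_column w [] i j

theorem wordCount_nil : wordCount [] = 1 := by
  unfold wordCount symTabCount
  rw [Set.ncard_eq_one]
  refine ⟨{(0, 0)}, ?_⟩
  have h0 : ∀ i j, cell [true] i j ↔ i = 0 ∧ j = 0 := by
    intro i j
    rcases i with _ | i <;> rcases j with _ | j <;> simp [cell]
  ext P
  constructor
  · intro h
    ext ⟨i, j⟩
    simp only [Finset.mem_singleton, Prod.mk.injEq]
    exact ⟨fun hij => (h0 i j).1 (h.sub hij), fun hij => by rw [hij.1, hij.2]; exact h.root⟩
  · rintro rfl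
    refine ⟨fun hij => by simpa [h0] using hij, fun hij => by simp at hij ⊢; omega, by simp,
      fun i j hij hne => absurd (by simpa using hij) hne, fun i hi => ⟨0, ?_⟩⟩
    simp [((h0 _ _).1 hi).1]

/-! ### Summing over words -/

/-- The words of length `n` in two letters. -/
def words : ℕ → Finset (List Bool)
  | 0 => {[]}
  | n + 1 => (words n).image (List.cons true) ∪ (words n).image (List.cons false)

theorem mem_words {n : ℕ} {w : List Bool} : w ∈ words n ↔ w.length = n := by
  induction n generalizing w with
  | zero => simp [words]
  | succ n ih => rcases w with _ | ⟨_ | _, w⟩ <;> simp [words, ih]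

theorem sum_words_succ {M : Type*} [AddCommMonoid M] (n : ℕ) (g : List Bool → M) :
    ∑ w ∈ words (n + 1), g w =
      ∑ w ∈ words n, g (true :: w) + ∑ w ∈ words n, g (false :: w) := by
  rw [words, Finset.sum_union, Finset.sum_image (by simp), Finset.sum_image (by simp)]
  rw [Finset.disjoint_left]
  simp

theorem sum_words_succ_append {M : Type*} [AddCommMonoid M] (n : ℕ) (v : List Bool)
    (g : List Bool → M) :
    ∑ w ∈ words (n + 1), g (w ++ v) =
      ∑ w ∈ words n, g (w ++ true :: v) + ∑ w ∈ words n, g (w ++ false :: v) := by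
  induction n generalizing g with
  | zero => simp [words]
  | succ n ih =>
    rw [sum_words_succ]
    simp only [List.cons_append]
    rw [ih fun w => g (true :: w), ih fun w => g (false :: w), sum_words_succ,
      sum_words_succ]
    simp only [List.cons_append]
    exact add_add_add_comm _ _ _ _

/-- The relation `NE = EN + N + E` in the middle of a word. -/
def CornerRelation (f : List Bool → ℚ) : Prop :=
  ∀ u v, f (u ++ true :: false :: v) =
    f (u ++ false :: true :: v) + f (u ++ true :: v) + f (u ++ false :: v)

/-- The letter `false` moves left through `u`. Passing a `true` leaves two extra terms, with either
letter at that place; passing a `false` leaves none. Each of the `n` places thus contributes one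
full sum over words. -/
theorem CornerRelation.sum_false {f : List Bool → ℚ} (hf : CornerRelation f) (n : ℕ)
    (v : List Bool) : ∑ u ∈ words n, f (u ++ false :: v) =
      ∑ u ∈ words n, f (false :: (u ++ v)) + n * ∑ u ∈ words n, f (u ++ v) := by
  induction n generalizing f with
  | zero => simp [words]
  | succ n ih =>
    have hcons : ∀ x, CornerRelation fun w => f (x :: w) := fun x u v => hf (x :: u) v
    have h := fun w => hf [] w
    simp only [List.nil_append] at h
    simp only [sum_words_succ, List.cons_append]
    rw [ih (hcons true), ih (hcons false)]
    simp only [h, Finset.sum_add_distrib]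
    push_cast
    ring

/-- Complement of `CornerRelation.sum_false` in the sum over both values of the moving letter, hence
the minus sign. -/
theorem CornerRelation.sum_true {f : List Bool → ℚ} (hf : CornerRelation f) (n : ℕ)
    (v : List Bool) : ∑ u ∈ words n, f (u ++ true :: v) =
      ∑ u ∈ words n, f (true :: (u ++ v)) - n * ∑ u ∈ words n, f (u ++ v) := by
  have h1 := sum_words_succ_append n v f
  rw [sum_words_succ, hf.sum_false] at h1
  simp only [List.cons_append] at h1
  linarith

theorem sum_words_add {M : Type*} [AddCommMonoid M] (m n : ℕ) (g : List Bool → M) :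
    ∑ v ∈ words m, ∑ u ∈ words n, g (u ++ v) = ∑ w ∈ words (n + m), g w := by
  induction n generalizing g with
  | zero => simp [words]
  | succ n ih =>
    rw [show n + 1 + m = n + m + 1 by ring]
    simp only [sum_words_succ, List.cons_append, Finset.sum_add_distrib]
    rw [ih fun w => g (true :: w), ih fun w => g (false :: w)]

theorem cornerRelation_wordCount : CornerRelation fun w => (wordCount w : ℚ) := by
  intro u v
  simp only
  rw [wordCount_swap]
  push_cast
  ring

theorem sum_wordCount_append_true (n : ℕ) :
    ∑ w ∈ words n, (wordCount (w ++ [true]) : ℚ) = (n + 1) * ∑ w ∈ words n, (wordCount w : ℚ) := by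
  simp only [← wordCount_append_false]
  have := cornerRelation_wordCount.sum_false n []
  simp only [List.append_nil, wordCount_false_cons] at this
  rw [this]
  ring

theorem sum_wordCount (n : ℕ) :
    ∑ w ∈ words n, (wordCount w : ℚ) = 2 ^ n * (n.factorial : ℚ) := by
  induction n with
  | zero => simp [words, wordCount_nil]
  | succ n ih =>
    have h := sum_words_succ_append n [] fun w => (wordCount w : ℚ)
    simp only [List.append_nil, wordCount_append_false] at h
    rw [h, sum_wordCount_append_true, ih, Nat.factorial_succ]
    push_cast
    ring

theorem sum_wordCount_corner (m n : ℕ) :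
    ∑ v ∈ words m, ∑ u ∈ words n, (wordCount (u ++ false :: true :: v) : ℚ) =
      (n + 1) * (2 ^ (n + m + 1) * ((n + m + 1).factorial : ℚ) -
        (n + 1) * (2 ^ (n + m) * ((n + m).factorial : ℚ))) := by
  have h1 : ∀ v, ∑ u ∈ words n, (wordCount (u ++ false :: true :: v) : ℚ) =
      (n + 1) * (∑ u ∈ words n, (wordCount (true :: (u ++ v)) : ℚ)
        - n * ∑ u ∈ words n, (wordCount (u ++ v) : ℚ)) := by
    intro v
    -- Once `false` reaches the front it can be dropped, so the two sums merge into `n + 1` equal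
    -- ones.
    have h := cornerRelation_wordCount.sum_false n (true :: v)
    simp only [wordCount_false_cons] at h
    rw [h, ← cornerRelation_wordCount.sum_true n v]
    ring
  have h2 := sum_words_add m n fun w => (wordCount w : ℚ)
  have h3 := sum_words_add m n fun w => (wordCount (true :: w) : ℚ)
  have h4 := sum_words_succ (n + m) fun w => (wordCount w : ℚ)
  simp only [wordCount_false_cons] at h4
  rw [sum_wordCount] at h2
  rw [sum_wordCount, sum_wordCount] at h4
  simp only [h1, ← Finset.mul_sum, Finset.sum_sub_distrib]
  rw [h2, h3]
  linear_combination (-(n + 1) : ℚ) * h4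

theorem sum_mul_factorial (n : ℕ) :
    2 * ∑ b ∈ Finset.range (n + 1), ((b : ℚ) + 1) * (2 ^ (n + 1) * ((n + 1).factorial : ℚ) -
        (b + 1) * (2 ^ n * (n.factorial : ℚ))) + (2 ^ (n + 1) * ((n + 2).factorial : ℚ)) =
      2 ^ (n + 2) * ((n + 2).factorial : ℚ) * ((4 * ((n + 2 : ℕ) : ℚ) + 1) / 12) := by
  have h1 : ∀ k : ℕ, ∑ b ∈ Finset.range k, ((b : ℚ) + 1) = (k : ℚ) * (k + 1) / 2 := by
    intro k
    induction k with
    | zero => simp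
    | succ k ih => rw [Finset.sum_range_succ, ih]; push_cast; ring
  have h2 : ∀ k : ℕ, ∑ b ∈ Finset.range k, ((b : ℚ) + 1) ^ 2 =
      (k : ℚ) * (k + 1) * (2 * k + 1) / 6 := by
    intro k
    induction k with
    | zero => simp
    | succ k ih => rw [Finset.sum_range_succ, ih]; push_cast; ring
  have h3 : ∑ b ∈ Finset.range (n + 1), ((b : ℚ) + 1) * (2 ^ (n + 1) * ((n + 1).factorial : ℚ) -
        (b + 1) * (2 ^ n * (n.factorial : ℚ))) =
      (2 ^ (n + 1) * ((n + 1).factorial : ℚ)) * ∑ b ∈ Finset.range (n + 1), ((b : ℚ) + 1) -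
        (2 ^ n * (n.factorial : ℚ)) * ∑ b ∈ Finset.range (n + 1), ((b : ℚ) + 1) ^ 2 := by
    rw [Finset.mul_sum, Finset.mul_sum, ← Finset.sum_sub_distrib]
    exact Finset.sum_congr rfl fun b _ => by ring
  rw [h3, h1, h2, Nat.factorial_succ (n + 1), Nat.factorial_succ n]
  push_cast
  ring

/-! ### From tableaux to words -/

theorem exists_cell_iff (n : ℕ) (D : ℕ → ℕ → Prop) (hsymm : ∀ i j, D i j → D j i)
    (hmono : ∀ i j, D (i + 1) j → D i j) (hn : ∀ i j, D i j → j < n) :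
    ∃ l : List Bool, l.length = n ∧ ∀ i j, D i j ↔ cell l i j := by
  have hrow : ∀ i j, D i j → D 0 j := by
    intro i j h
    induction i with
    | zero => exact h
    | succ i ih => exact ih (hmono _ _ h)
  have hle : ∀ j k, j ≤ k → D 0 k → D 0 j := by
    intro j k hjk h
    induction k, hjk using Nat.le_induction with
    | base => exact h
    | succ k _ ih => exact ih (hsymm _ _ (hmono _ _ (hsymm _ _ h)))
  induction n generalizing D with
  | zero => exact ⟨[], rfl, fun i j => iff_of_false (fun h => absurd (hn i j h) (by omega)) id⟩
  | succ n ih =>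
    -- If the first row fills the box, a full hook is stripped; otherwise the diagram fits in the
    -- next smaller box.
    by_cases h0 : D 0 n
    · obtain ⟨l, hl, hD⟩ := ih (fun i j => D (i + 1) (j + 1)) (fun i j => hsymm _ _)
        (fun i j => hmono _ _) (fun i j h => by have := hn _ _ h; omega)
        (fun i j h => by
          induction i with
          | zero => exact h
          | succ i ih => exact ih (hmono _ _ h))
        (fun j k hjk h => by
          induction k, hjk using Nat.le_induction with
          | base => exact h
          | succ k _ ih => exact ih (hsymm _ _ (hmono _ _ (hsymm _ _ h))))
      have hz : ∀ j, D 0 j ↔ j ≤ n :=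
        fun j => ⟨fun h => Nat.lt_succ_iff.1 (hn _ _ h), fun h => hle _ _ h h0⟩
      refine ⟨true :: l, by simp [hl], fun i j => ?_⟩
      rcases i with _ | i
      · simp only [cell, hl, hz]
      rcases j with _ | j
      · simp only [cell, hl]
        rw [← hz]
        exact ⟨hsymm _ _, hsymm _ _⟩
      · exact hD i j
    · obtain ⟨l, hl, hD⟩ := ih D hsymm hmono (fun i j h => by
        have h1 := hn _ _ h
        have h2 : j ≠ n := fun he => h0 (he ▸ hrow _ _ h)
        omega) hrow hle
      exact ⟨false :: l, by simp [hl], hD⟩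

/-- The lengths must agree because leading `false` letters add no cells. -/
theorem cell_injective : ∀ {l l' : List Bool}, l.length = l'.length →
    (∀ i j, cell l i j ↔ cell l' i j) → l = l'
  | [], [], _, _ => rfl
  | false :: l, false :: l', h, hc => by
    rw [cell_injective (l := l) (l' := l') (by simpa using h) hc]
  | true :: l, true :: l', h, hc => by
    rw [cell_injective (l := l) (l' := l') (by simpa using h) fun i j => hc (i + 1) (j + 1)]
  | true :: l, false :: l', h, hc => by
    have h1 : cell l' 0 l.length := (hc 0 l.length).1 (by simp [cell])
    have := (cell_lt _ _ _ h1).2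
    simp at h; omega
  | false :: l, true :: l', h, hc => by
    have h1 : cell l 0 l'.length := (hc 0 l'.length).2 (by simp [cell])
    have := (cell_lt _ _ _ h1).2
    simp at h; omega

open Classical in
/-- The diagram of a word as a Young diagram. -/
noncomputable def wordShape (l : List Bool) : YoungDiagram where
  cells := (Finset.range l.length ×ˢ Finset.range l.length).filter fun c => cell l c.1 c.2
  isLowerSet := by
    rintro ⟨i, j⟩ ⟨i', j'⟩ ⟨hi, hj⟩ h
    simp only [Finset.coe_filter, Finset.mem_product, Finset.mem_range, Set.mem_ofPred_eq] at h ⊢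
    have hc := cell_mono l h.2 hi hj
    exact ⟨cell_lt _ _ _ hc, hc⟩

theorem mem_wordShape {l : List Bool} {i j : ℕ} : (i, j) ∈ wordShape l ↔ cell l i j := by
  rw [← YoungDiagram.mem_cells]
  simp only [wordShape, Finset.mem_filter, Finset.mem_product, Finset.mem_range]
  exact ⟨fun h => h.2, fun h => ⟨cell_lt _ _ _ h, h⟩⟩

namespace TreeLikeTableau

theorem IsSymmetric.swap_mem_shape {T : TreeLikeTableau} (hT : T.IsSymmetric) {i j : ℕ} :
    (i, j) ∈ T.shape ↔ (j, i) ∈ T.shape := by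
  conv_lhs => rw [← hT.1]
  rw [YoungDiagram.mem_transpose]
  rfl

theorem IsSymmetric.swap_mem_points {T : TreeLikeTableau} (hT : T.IsSymmetric) {i j : ℕ} :
    (i, j) ∈ T.points ↔ (j, i) ∈ T.points := by
  conv_lhs => rw [← hT.2]
  simp

theorem mem_shape_of_mem_points (T : TreeLikeTableau) {c : ℕ × ℕ} (h : c ∈ T.points) :
    c ∈ T.shape := T.points_subset h

theorem IsSymmetric.isSymTab {T : TreeLikeTableau} (hT : T.IsSymmetric) {l : List Bool}
    (hl : T.shape = wordShape l) : IsSymTab (cell l) T.points := by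
  refine ⟨fun h => ?_, fun h => hT.swap_mem_points.1 h, T.root_mem, fun i j h => T.parent _ h,
    fun i hi => T.row_nonempty i ?_⟩
  · rw [← mem_wordShape, ← hl]; exact T.mem_shape_of_mem_points h
  · rw [hl, mem_wordShape]; exact hi

end TreeLikeTableau

/-- A symmetric filling of the diagram of a word as a tree-like tableau. -/
noncomputable def IsSymTab.toTableau {l : List Bool} {P : Finset (ℕ × ℕ)}
    (h : IsSymTab (cell l) P) : TreeLikeTableau where
  shape := wordShape l
  points := P
  points_subset := fun _ hc => mem_wordShape.2 (h.sub hc)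
  root_mem := h.root
  parent := fun _ hc => h.parent _ _ hc
  row_nonempty := fun i hi => h.row i (mem_wordShape.1 hi)
  col_nonempty := fun j hj => by
    obtain ⟨i, hi⟩ := h.row j (cell_symm _ _ _ (mem_wordShape.1 hj))
    exact ⟨i, h.symm hi⟩

theorem IsSymTab.isSymmetric_toTableau {l : List Bool} {P : Finset (ℕ × ℕ)}
    (h : IsSymTab (cell l) P) : h.toTableau.IsSymmetric := by
  constructor
  · ext ⟨i, j⟩
    rw [YoungDiagram.mem_cells, YoungDiagram.mem_cells, YoungDiagram.mem_transpose]
    exact mem_wordShape.trans (Iff.trans ⟨cell_symm _ _ _, cell_symm _ _ _⟩ mem_wordShape.symm)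
  · ext ⟨i, j⟩
    simp only [Finset.mem_image, Prod.exists, Prod.swap_prod_mk, Prod.mk.injEq]
    constructor
    · rintro ⟨a, b, hab, rfl, rfl⟩; exact h.symm hab
    · intro hij; exact ⟨j, i, h.symm hij, rfl, rfl⟩

/-! ### Size and side length -/

namespace TreeLikeTableau

theorem card_leftmost (T : TreeLikeTableau) [DecidablePred fun c : ℕ × ℕ =>
    ∃ j < c.2, (c.1, j) ∈ T.points] :
    (T.points.filter fun c => ¬ ∃ j < c.2, (c.1, j) ∈ T.points).card = T.shape.colLen 0 := by
  rw [← Finset.card_range (T.shape.colLen 0)]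
  refine Finset.card_bij (fun c _ => c.1) ?_ ?_ ?_
  · rintro ⟨i, j⟩ h
    rw [Finset.mem_filter] at h
    rw [Finset.mem_range, ← YoungDiagram.mem_iff_lt_colLen]
    exact T.shape.up_left_mem le_rfl (Nat.zero_le j) (T.mem_shape_of_mem_points h.1)
  · rintro ⟨i, j⟩ h ⟨i', j'⟩ h' he
    simp only [Finset.mem_filter] at h h' he
    subst he
    rcases lt_trichotomy j j' with hlt | rfl | hlt
    · exact absurd ⟨j, hlt, h.1⟩ h'.2
    · rfl
    · exact absurd ⟨j', hlt, h'.1⟩ h.2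
  · intro i hi
    rw [Finset.mem_range, ← YoungDiagram.mem_iff_lt_colLen] at hi
    classical
    have hex := T.row_nonempty i hi
    refine ⟨(i, Nat.find hex), ?_, rfl⟩
    rw [Finset.mem_filter]
    refine ⟨Nat.find_spec hex, ?_⟩
    rintro ⟨j, hj, hjP⟩
    exact Nat.find_min hex hj hjP

/-- The semi-perimeter of a symmetric tableau is its size plus one. -/
theorem IsSymmetric.size_add_one {T : TreeLikeTableau} (hT : T.IsSymmetric) :
    T.size + 1 = 2 * T.shape.rowLen 0 := by
  classical
  have hlen : T.shape.colLen 0 = T.shape.rowLen 0 := by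
    rw [← YoungDiagram.rowLen_transpose, hT.1]
  have hl := T.card_leftmost
  -- `L` has one point per row, and its mirror image consists of the topmost points of the columns.
  -- By the parent condition a non-root point lies in exactly one of the two sets; the root lies in
  -- both.
  set L := T.points.filter fun c => ¬ ∃ j < c.2, (c.1, j) ∈ T.points with hL
  have hmem : ∀ i j, (i, j) ∈ L.image Prod.swap ↔
      (i, j) ∈ T.points ∧ ¬ ∃ a < i, (a, j) ∈ T.points := by
    intro i j
    simp only [hL, Finset.mem_image, Finset.mem_filter, Prod.exists, Prod.swap_prod_mk,
      Prod.mk.injEq]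
    constructor
    · rintro ⟨a, b, ⟨h1, h2⟩, rfl, rfl⟩
      refine ⟨hT.swap_mem_points.1 h1, ?_⟩
      rintro ⟨x, hx, hxP⟩
      exact h2 ⟨x, hx, hT.swap_mem_points.1 hxP⟩
    · rintro ⟨h1, h2⟩
      refine ⟨j, i, ⟨hT.swap_mem_points.1 h1, ?_⟩, rfl, rfl⟩
      rintro ⟨x, hx, hxP⟩
      exact h2 ⟨x, hx, hT.swap_mem_points.1 hxP⟩
  have hunion : L ∪ L.image Prod.swap = T.points := by
    ext ⟨i, j⟩
    rw [Finset.mem_union, hmem, hL, Finset.mem_filter]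
    refine ⟨fun h => h.elim (·.1) (·.1), fun h => ?_⟩
    by_cases h0 : (i, j) = (0, 0)
    · simp only [Prod.mk.injEq] at h0
      exact Or.inl ⟨h, fun ⟨x, hx, _⟩ => by simp [h0.2] at hx⟩
    · rcases T.parent _ h h0 with ⟨-, h2⟩ | ⟨-, h2⟩
      · exact Or.inl ⟨h, h2⟩
      · exact Or.inr ⟨h, h2⟩
  have hinter : L ∩ L.image Prod.swap = {(0, 0)} := by
    ext ⟨i, j⟩
    rw [Finset.mem_inter, hmem, hL, Finset.mem_filter, Finset.mem_singleton]
    constructor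
    · rintro ⟨⟨h, h1⟩, -, h2⟩
      by_contra h0
      rcases T.parent _ h h0 with ⟨h3, -⟩ | ⟨h3, -⟩
      · exact h2 h3
      · exact h1 h3
    · intro h0
      simp only [Prod.mk.injEq] at h0
      obtain ⟨rfl, rfl⟩ := h0
      simp [T.root_mem]
  have h := Finset.card_union_add_card_inter L (L.image Prod.swap)
  rw [hunion, hinter, Finset.card_image_of_injective _ Prod.swap_injective, hl,
    Finset.card_singleton, hlen] at h
  rw [size, h]
  ring

theorem mem_symmetricOfSize_iff {T : TreeLikeTableau} {n : ℕ} :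
    T ∈ symmetricOfSize (2 * n + 1) ↔
      T.IsSymmetric ∧ ∃ w, w.length = n ∧ T.shape = wordShape (true :: w) := by
  constructor
  · rintro ⟨hT, hs⟩
    have hlen := hT.size_add_one
    refine ⟨hT, ?_⟩
    obtain ⟨l, hl, hD⟩ := exists_cell_iff (n + 1) (fun i j => (i, j) ∈ T.shape)
      (fun i j h => hT.swap_mem_shape.1 h)
      (fun i j h => T.shape.up_left_mem (Nat.le_succ i) le_rfl h)
      (fun i j h => by
        have := T.shape.up_left_mem (Nat.zero_le i) le_rfl h
        rw [YoungDiagram.mem_iff_lt_rowLen] at this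
        omega)
    have hn : cell l 0 n := (hD 0 n).1 (YoungDiagram.mem_iff_lt_rowLen.2 (by omega))
    have hshape : T.shape = wordShape l := by
      ext ⟨i, j⟩
      exact (hD i j).trans mem_wordShape.symm
    rcases l with _ | ⟨_ | _, w⟩
    · exact hn.elim
    · have := (cell_lt w 0 n hn).2
      simp at hl; omega
    · exact ⟨w, by simpa using hl, hshape⟩
  · rintro ⟨hT, w, rfl, hshape⟩
    refine ⟨hT, ?_⟩
    have hlen := hT.size_add_one
    have h1 : T.shape.rowLen 0 = w.length + 1 := by
      have h : ∀ j, j < T.shape.rowLen 0 ↔ j < w.length + 1 := by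
        intro j
        rw [← YoungDiagram.mem_iff_lt_rowLen, hshape, mem_wordShape, cell, Nat.lt_succ_iff]
      have h2 := h (w.length + 1)
      have h3 := h w.length
      omega
    omega

/-! ### Counting empty corners -/

/-- The tableaux on the diagram of a word with an empty corner in a given cell. -/
def cornerFiber (w : List Bool) (c : ℕ × ℕ) : Set (TreeLikeTableau × (ℕ × ℕ)) :=
  {p | p.1.IsSymmetric ∧ p.1.shape = wordShape (true :: w) ∧ p.1.IsNonOccupiedCorner p.2 ∧
    p.2 = c}

theorem isCorner_iff {T : TreeLikeTableau} {l : List Bool} (h : T.shape = wordShape l) (r c : ℕ) :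
    T.IsCorner (r, c) ↔ IsCellCorner l r c := by
  simp only [IsCorner, IsCellCorner, h, mem_wordShape]

theorem image_cornerFiber {w : List Bool} {r c : ℕ} (h : IsCellCorner (true :: w) r c) :
    (fun p : TreeLikeTableau × (ℕ × ℕ) => p.1.points) '' cornerFiber w (r, c) =
      {P | IsSymTab (cell (true :: w)) P ∧ (r, c) ∉ P} := by
  ext P
  constructor
  · rintro ⟨⟨T, _⟩, ⟨hT, hs, hc, rfl⟩, rfl⟩
    exact ⟨hT.isSymTab hs, hc.2⟩
  · rintro ⟨hP, hc⟩
    exact ⟨(hP.toTableau, (r, c)),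
      ⟨hP.isSymmetric_toTableau, rfl, ⟨(isCorner_iff rfl r c).2 h, hc⟩, rfl⟩, rfl⟩

theorem injOn_cornerFiber (w : List Bool) (c : ℕ × ℕ) :
    Set.InjOn (fun p : TreeLikeTableau × (ℕ × ℕ) => p.1.points) (cornerFiber w c) := by
  rintro ⟨T, _⟩ ⟨hT, hs, hc, rfl⟩ ⟨T', _⟩ ⟨hT', hs', hc', rfl⟩ he
  exact Prod.ext (TreeLikeTableau.ext (hs.trans hs'.symm) he) rfl

theorem ncard_cornerFiber {w : List Bool} {r c : ℕ} (h : IsCellCorner (true :: w) r c) :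
    (cornerFiber w (r, c)).ncard = {P | IsSymTab (cell (true :: w)) P ∧ (r, c) ∉ P}.ncard := by
  rw [← image_cornerFiber h, (injOn_cornerFiber _ _).ncard_image]

theorem finite_cornerFiber {w : List Bool} {r c : ℕ} (h : IsCellCorner (true :: w) r c) :
    (cornerFiber w (r, c)).Finite := by
  refine Set.Finite.of_finite_image ?_ (injOn_cornerFiber _ _)
  rw [image_cornerFiber h]
  exact (finite_isSymTab (cell_lt (true :: w))).subset fun P hP => hP.1

theorem isCellCorner_swap (u v : List Bool) : IsCellCorner (true :: (u ++ true :: false :: v))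
    (u.count true + 1) (u.count true + 1 + v.length + 1) :=
  (isCellCorner_iff _ _ _ (by omega)).2 ⟨true :: u, v, rfl, by simp, rfl⟩

theorem isCellCorner_diag (u : List Bool) : IsCellCorner (true :: (u ++ [true]))
    (u.count true + 1) (u.count true + 1) :=
  (isCellCorner_diag_iff _ _).2 ⟨true :: u, rfl, by simp⟩

/-- An empty corner can be cut off, which exchanges its two letters. -/
theorem ncard_cornerFiber_swap (u v : List Bool) :
    (cornerFiber (u ++ true :: false :: v)
      (u.count true + 1, u.count true + 1 + v.length + 1)).ncard =
      wordCount (u ++ false :: true :: v) := by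
  rw [ncard_cornerFiber (isCellCorner_swap u v), wordCount, symTabCount]
  congr 1
  ext P
  refine isSymTab_and_notMem_iff (by omega) (by omega) (fun i j => ?_) P
  simpa using cell_swap v (true :: u) i j

theorem ncard_cornerFiber_diag (u : List Bool) :
    (cornerFiber (u ++ [true]) (u.count true + 1, u.count true + 1)).ncard =
      wordCount (u ++ [true]) := by
  rw [ncard_cornerFiber (isCellCorner_diag u), wordCount, symTabCount]
  congr 1
  ext P
  exact ⟨fun h => h.1, fun h => ⟨h, fun hP => absurd (h.eq_zero_of_diag hP) (by omega)⟩⟩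

theorem wordShape_injective {l l' : List Bool} (h : l.length = l'.length)
    (hs : wordShape l = wordShape l') : l = l' :=
  cell_injective h fun i j => by rw [← mem_wordShape, hs, mem_wordShape]

theorem eq_of_mem_cornerFiber {w w' : List Bool} {c c' : ℕ × ℕ} (h : w.length = w'.length)
    {p : TreeLikeTableau × (ℕ × ℕ)} (hp : p ∈ cornerFiber w c) (hp' : p ∈ cornerFiber w' c') :
    w = w' ∧ c = c' := by
  obtain ⟨-, h1, -, rfl⟩ := hp
  obtain ⟨-, h2, -, rfl⟩ := hp'
  have := wordShape_injective (by simpa using h) (h1.symm.trans h2)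
  exact ⟨by simpa using this, rfl⟩

theorem ncard_biUnion_finset {ι α : Type*} (s : Finset ι) (t : ι → Set α)
    (ht : ∀ i ∈ s, (t i).Finite) (hd : (s : Set ι).PairwiseDisjoint t) :
    (⋃ i ∈ s, t i).Finite ∧ (⋃ i ∈ s, t i).ncard = ∑ i ∈ s, (t i).ncard := by
  refine ⟨Set.Finite.biUnion s.finite_toSet ht, ?_⟩
  have := s.finite_toSet.ncard_biUnion ht hd
  rw [finsum_mem_coe_finset] at this
  exact this

theorem diagonal_nonOccupiedCorners (n : ℕ) :
    {p ∈ nonOccupiedCorners (symmetricOfSize (2 * (n + 1) + 1)) | p.2.1 = p.2.2} =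
      ⋃ u ∈ words n, cornerFiber (u ++ [true]) (u.count true + 1, u.count true + 1) := by
  ext ⟨T, r, c⟩
  simp only [Set.mem_iUnion, exists_prop, mem_words]
  constructor
  · rintro ⟨⟨hT, hc⟩, hrc⟩
    dsimp only at hT hc hrc
    subst hrc
    obtain ⟨hsym, w, hw, hs⟩ := mem_symmetricOfSize_iff.1 hT
    obtain ⟨u, hu, hr⟩ := (isCellCorner_diag_iff _ _).1 ((isCorner_iff hs _ _).1 hc.1)
    -- For empty `u` the corner would be the root of a one-cell diagram, but `w` has length `n + 1`.
    rcases u with _ | ⟨x, u⟩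
    · simp at hu; subst hu; simp at hw
    · simp only [List.cons_append, List.cons.injEq] at hu
      obtain ⟨rfl, rfl⟩ := hu
      exact ⟨u, by simpa using hw, hsym, hs, hc, by simp [hr]⟩
  · rintro ⟨u, hu, hsym, hs, hc, he⟩
    dsimp only at hsym hs hc he
    simp only [Prod.mk.injEq] at he
    exact ⟨⟨mem_symmetricOfSize_iff.2 ⟨hsym, _, by simp [hu], hs⟩, hc⟩, by simp [he.1, he.2]⟩

theorem ncard_diagonal (n : ℕ) :
    {p ∈ nonOccupiedCorners (symmetricOfSize (2 * (n + 1) + 1)) | p.2.1 = p.2.2}.Finite ∧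
    ({p ∈ nonOccupiedCorners (symmetricOfSize (2 * (n + 1) + 1)) | p.2.1 = p.2.2}.ncard : ℚ) =
      2 ^ n * ((n + 1).factorial : ℚ) := by
  rw [diagonal_nonOccupiedCorners]
  have h := ncard_biUnion_finset (words n)
    (fun u => cornerFiber (u ++ [true]) (u.count true + 1, u.count true + 1))
    (fun u _ => finite_cornerFiber (isCellCorner_diag u)) ?_
  · refine ⟨h.1, ?_⟩
    rw [h.2]
    push_cast
    simp only [ncard_cornerFiber_diag]
    rw [sum_wordCount_append_true, sum_wordCount, Nat.factorial_succ]
    push_cast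
    ring
  · intro u hu u' hu' hne
    rw [Function.onFun, Set.disjoint_left]
    intro p hp hp'
    rw [Finset.mem_coe, mem_words] at hu hu'
    exact hne (List.append_left_injective _
      (eq_of_mem_cornerFiber (by simp [hu, hu']) hp hp').1)

theorem upper_nonOccupiedCorners (n : ℕ) :
    {p ∈ nonOccupiedCorners (symmetricOfSize (2 * n + 1)) | p.2.1 < p.2.2} =
      ⋃ i ∈ (Finset.range (n - 1)).sigma fun b => words (n - 2 - b) ×ˢ words b,
        cornerFiber (i.2.2 ++ true :: false :: i.2.1)
          (i.2.2.count true + 1, i.2.2.count true + 1 + i.2.1.length + 1) := by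
  ext ⟨T, r, c⟩
  simp only [Set.mem_iUnion, exists_prop, Finset.mem_sigma, Finset.mem_product, mem_words,
    Finset.mem_range]
  constructor
  · rintro ⟨⟨hT, hc⟩, hrc⟩
    dsimp only at hT hc hrc
    obtain ⟨hsym, w, hw, hs⟩ := mem_symmetricOfSize_iff.1 hT
    obtain ⟨u, v, hu, hr, hcv⟩ := (isCellCorner_iff _ _ _ hrc).1 ((isCorner_iff hs _ _).1 hc.1)
    rcases u with _ | ⟨x, u⟩
    -- A corner in row `0` is the only cell of its column, so it is pointed.
    · exfalso
      simp only [List.nil_append, List.cons.injEq, true_and] at hu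
      subst hu
      have hlast := cell_last_column v
      have hc0 := cell_symm _ _ _ ((hlast 0).2 rfl)
      refine hc.2 (((hsym.isSymTab hs).mem_of_column ?_ (m := 0) ?_ r).2 (by simpa using hr))
      · rw [hcv, hr]; simpa using hc0
      · intro i
        rw [hcv, hr]; simpa using hlast i
    · simp only [List.cons_append, List.cons.injEq] at hu
      obtain ⟨rfl, rfl⟩ := hu
      simp only [List.length_append, List.length_cons] at hw
      refine ⟨⟨u.length, v, u⟩, ⟨by dsimp only; omega, by dsimp only; omega, rfl⟩, hsym, hs, hc, ?_⟩
      simp only [List.count_cons_self] at hr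
      simp [hr, hcv]
  · rintro ⟨⟨b, v, u⟩, ⟨hb, hv, hu⟩, hsym, hs, hc, he⟩
    dsimp only at hsym hs hc he hb hv hu
    simp only [Prod.mk.injEq] at he
    refine ⟨⟨mem_symmetricOfSize_iff.2 ⟨hsym, _, ?_, hs⟩, hc⟩, ?_⟩
    · simp; omega
    · dsimp only; omega

theorem ncard_upper (n : ℕ) :
    {p ∈ nonOccupiedCorners (symmetricOfSize (2 * n + 1)) | p.2.1 < p.2.2}.Finite ∧
    ({p ∈ nonOccupiedCorners (symmetricOfSize (2 * n + 1)) | p.2.1 < p.2.2}.ncard : ℚ) =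
      ∑ b ∈ Finset.range (n - 1), ∑ v ∈ words (n - 2 - b), ∑ u ∈ words b,
        (wordCount (u ++ false :: true :: v) : ℚ) := by
  rw [upper_nonOccupiedCorners]
  have h := ncard_biUnion_finset
    ((Finset.range (n - 1)).sigma fun b => words (n - 2 - b) ×ˢ words b)
    (fun i => cornerFiber (i.2.2 ++ true :: false :: i.2.1)
          (i.2.2.count true + 1, i.2.2.count true + 1 + i.2.1.length + 1))
    (fun i _ => finite_cornerFiber (isCellCorner_swap _ _)) ?_
  · refine ⟨h.1, ?_⟩
    rw [h.2]
    push_cast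
    simp only [ncard_cornerFiber_swap]
    rw [Finset.sum_sigma]
    simp only [Finset.sum_product]
  · rintro ⟨b, v, u⟩ hi ⟨b', v', u'⟩ hi' hne
    rw [Function.onFun, Set.disjoint_left]
    intro p hp hp'
    simp only [Finset.mem_coe, Finset.mem_sigma, Finset.mem_product, mem_words,
      Finset.mem_range] at hi hi'
    dsimp only at hp hp' hi hi'
    have hl : (u ++ true :: false :: v).length = (u' ++ true :: false :: v').length := by
      simp only [List.length_append, List.length_cons]
      omega
    obtain ⟨h1, h2⟩ := eq_of_mem_cornerFiber hl hp hp'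
    simp only [Prod.mk.injEq] at h2
    have hlen := congrArg List.length h1
    simp only [List.length_append, List.length_cons] at hlen
    -- Equal coordinates force `v` and `v'` to be equally long, so both words split at the same
    -- place.
    obtain ⟨h3, h4⟩ := List.append_inj h1 (by omega)
    simp only [List.cons.injEq, true_and] at h4
    apply hne
    obtain ⟨-, -, rfl⟩ := hi
    obtain ⟨-, -, rfl⟩ := hi'
    subst h3 h4
    rfl

theorem IsSymmetric.isNonOccupiedCorner_swap {T : TreeLikeTableau} (hT : T.IsSymmetric)
    {c : ℕ × ℕ} (h : T.IsNonOccupiedCorner c) : T.IsNonOccupiedCorner c.swap := by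
  obtain ⟨⟨h1, h2, h3⟩, h4⟩ := h
  exact ⟨⟨hT.swap_mem_shape.1 h1, fun h => h3 (hT.swap_mem_shape.1 h),
    fun h => h2 (hT.swap_mem_shape.1 h)⟩, fun h => h4 (hT.swap_mem_points.1 h)⟩

theorem lower_nonOccupiedCorners (m : ℕ) :
    {p ∈ nonOccupiedCorners (symmetricOfSize m) | p.2.2 < p.2.1} =
      Prod.map id Prod.swap '' {p ∈ nonOccupiedCorners (symmetricOfSize m) | p.2.1 < p.2.2} := by
  ext ⟨T, r, c⟩
  constructor
  · rintro ⟨⟨hT, hc⟩, hrc⟩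
    exact ⟨(T, c, r), ⟨⟨hT, hT.1.isNonOccupiedCorner_swap hc⟩, hrc⟩, rfl⟩
  · rintro ⟨⟨T, r, c⟩, ⟨⟨hT, hc⟩, hrc⟩, he⟩
    simp only [Prod.map_apply, id_eq, Prod.swap_prod_mk, Prod.mk.injEq] at he
    obtain ⟨rfl, rfl, rfl⟩ := he
    exact ⟨⟨hT, hT.1.isNonOccupiedCorner_swap hc⟩, hrc⟩

theorem ncard_nonOccupiedCorners (n : ℕ) :
    ((nonOccupiedCorners (symmetricOfSize (2 * (n + 1) + 1))).ncard : ℚ) =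
      2 * ∑ b ∈ Finset.range n, ∑ v ∈ words (n - 1 - b), ∑ u ∈ words b,
        (wordCount (u ++ false :: true :: v) : ℚ) + 2 ^ n * ((n + 1).factorial : ℚ) := by
  have hU := ncard_upper (n + 1)
  have hD := ncard_diagonal n
  have hinj : Function.Injective (Prod.map id Prod.swap :
      TreeLikeTableau × (ℕ × ℕ) → TreeLikeTableau × (ℕ × ℕ)) :=
    Function.Injective.prodMap Function.injective_id Prod.swap_injective
  have hL := lower_nonOccupiedCorners (2 * (n + 1) + 1)
  have hLc := Set.ncard_image_of_injective
    {p ∈ nonOccupiedCorners (symmetricOfSize (2 * (n + 1) + 1)) | p.2.1 < p.2.2} hinj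
  have hLf := hU.1.image (Prod.map id Prod.swap)
  rw [← hL] at hLc hLf
  have hsplit : nonOccupiedCorners (symmetricOfSize (2 * (n + 1) + 1)) =
      ({p ∈ nonOccupiedCorners (symmetricOfSize (2 * (n + 1) + 1)) | p.2.1 < p.2.2} ∪
      {p ∈ nonOccupiedCorners (symmetricOfSize (2 * (n + 1) + 1)) | p.2.2 < p.2.1}) ∪
      {p ∈ nonOccupiedCorners (symmetricOfSize (2 * (n + 1) + 1)) | p.2.1 = p.2.2} := by
    ext p
    constructor
    · intro hp
      rcases lt_trichotomy p.2.1 p.2.2 with h | h | h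
      · exact Or.inl (Or.inl ⟨hp, h⟩)
      · exact Or.inr ⟨hp, h⟩
      · exact Or.inl (Or.inr ⟨hp, h⟩)
    · rintro ((h | h) | h) <;> exact h.1
  rw [hsplit, Set.ncard_union_eq ?_ (hU.1.union hLf) hD.1, Set.ncard_union_eq ?_ hU.1 hLf, hLc]
  · push_cast
    rw [hD.2, hU.2]
    simp only [Nat.add_sub_cancel, show n + 1 - 2 = n - 1 by omega]
    ring
  · rw [Set.disjoint_left]
    rintro p ⟨-, h⟩ ⟨-, h'⟩
    exact absurd h h'.asymm
  · rw [Set.disjoint_left]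
    rintro p (⟨-, h⟩ | ⟨-, h⟩) ⟨-, h'⟩ <;> omega

end TreeLikeTableau

theorem mainTheorem5 :
    (TreeLikeTableau.nonOccupiedCorners (TreeLikeTableau.symmetricOfSize 3)).ncard = 1 ∧
    ∀ n : ℕ, 2 ≤ n →
      ((TreeLikeTableau.nonOccupiedCorners
          (TreeLikeTableau.symmetricOfSize (2 * n + 1))).ncard : ℚ) =
        2 ^ n * (n.factorial : ℚ) * ((4 * (n : ℚ) + 1) / 12) := by
  constructor
  · have h := TreeLikeTableau.ncard_nonOccupiedCorners 0
    simpa using h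
  · intro n hn
    obtain ⟨n, rfl⟩ := Nat.exists_eq_add_of_le' hn
    rw [TreeLikeTableau.ncard_nonOccupiedCorners (n + 1), ← sum_mul_factorial]
    congr 2
    refine Finset.sum_congr rfl fun b hb => ?_
    rw [Finset.mem_range] at hb
    -- Since `b ≤ n` the subtraction is not truncated, and every summand involves the same two
    -- factorials.
    rw [sum_wordCount_corner, show b + (n + 1 - 1 - b) = n by omega]
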